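/- Let $n\ge 2$ and let $D_n\subseteq\mathbb{Q}^n$ be any subset that is dense in the usual (product) topology of $\mathbb{Q}^n$ and in which no two distinct points share a coordinate. Let $<$ be the product order on $D_n$: $\mathbf a<\mathbf b$ if and only if $a_i\le b_i$ for all $i\le n$ and $\mathbf a\ne\mathbf b$. For $i\le n$, let $<_i$ be the $i$th coordinate order on $D_n$: $\mathbf a<_i\mathbf b$ if and only if $a_i<b_i$. Let $\mathrm{Aut}(D_n,<)$ be the automorphism group of $(D_n,<)$ with the topology of pointwise convergence ($D_n$ being discrete). Let $\mathcal{R}_n$ be the set of realizers of $<$, i.e. of $n$-tuples $(\prec_1,\ldots,\prec_n)$ of strict linear orders on $D_n$ with $<\;=\;\prec_1\cap\cdots\cap\prec_n$, regarded as a subspace of $\{0,1\}^{\{1,\ldots,n\}\times D_n\times D_n}$. The logic action of $\mathrm{Aut}(D_n,<)$ on $\mathcal{R}_n$ is $g\cdot(\prec_1,\ldots,\prec_n)=(\prec_1^g,\ldots,\prec_n^g)$, where $\mathbf a\prec_i^g\mathbf b$ if and only if $g^{-1}(\mathbf a)\prec_i g^{-1}(\mathbf b)$. Then the logic action of $G=\mathrm{Aut}(D_n,<)$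 on $\mathcal{R}_n$ is the universal minimal flow of $G$; that is, $\mathcal{R}_n$ is a nonempty compact Hausdorff space on which $G$ acts continuously and minimally (every orbit is dense), and for every continuous minimal action of $G$ on a nonempty compact Hausdorff space $Y$ there is a continuous surjection $\phi:\mathcal{R}_n\to Y$ with $\phi(g\cdot x)=g\cdot\phi(x)$ for all $g\in G$ and $x\in\mathcal{R}_n$. Moreover, $\mathcal{R}_n$ is finite with $|\mathcal{R}_n|=n!$, and it consists exactly of the tuples $(<_{\sigma(1)},\ldots,<_{\sigma(n)})$ for $\sigma$ a permutation of $\{1,\ldots,n\}$. -/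

import Mathlib

universe u v w

section PointwiseConvergence

variable {P : Type u}

/-- The topology of pointwise convergence on the automorphism group of a structure `(P, r)`:
the subspace topology inherited from `P → P`, where `P` itself is discrete (whatever other
topology the type `P` may carry). -/
instance relAutTopology (r : P → P → Prop) : TopologicalSpace (r ≃r r) :=
  TopologicalSpace.induced (fun g : r ≃r r => (g : P → P))
    (@Pi.topologicalSpace P (fun _ => P) (fun _ => ⊥))

end PointwiseConvergence

/-- An `n`-tuple of (strict) linear orders on `P` that realize the relation `r`,
i.e. whose intersection is `r`. -/
@[ext]
structure Realizer (n : ℕ) {P : Type u} (r : P → P → Prop) where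
  /-- the `n` relations -/
  rel : Fin n → P → P → Prop
  isLinear : ∀ i, IsStrictTotalOrder P (rel i)
  realizes : ∀ a b, r a b ↔ ∀ i, rel i a b

namespace Realizer

variable {n : ℕ} {P : Type u} {r : P → P → Prop}

/-- The logic action of an automorphism on a tuple of realizers:
`a ≺ᵢᵍ b` if and only if `g⁻¹ a ≺ᵢ g⁻¹ b`. -/
def logicAct (g : r ≃r r) (R : Realizer n r) : Realizer n r where
  rel i a b := R.rel i (g⁻¹ a) (g⁻¹ b)
  isLinear i := by
    have := R.isLinear i
    exact (RelEmbedding.preimage (g⁻¹ : r ≃r r).toEquiv.toEmbedding (R.rel i)).isStrictTotalOrder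
  realizes a b := (RelIso.map_rel_iff (g⁻¹ : r ≃r r)).symm.trans (R.realizes _ _)

instance : MulAction (r ≃r r) (Realizer n r) where
  smul := logicAct
  one_smul R := rfl
  mul_smul g h R := by
    ext i a b
    change R.rel i ((g * h)⁻¹ a) ((g * h)⁻¹ b) ↔ R.rel i (h⁻¹ (g⁻¹ a)) (h⁻¹ (g⁻¹ b))
    rw [mul_inv_rev]
    rfl

open Classical in
/-- The topology on the set of realizers as a subspace of the compact space `{0,1}^(n × P × P)`,
a tuple of relations being identified with its characteristic function. -/
noncomputable instance : TopologicalSpace (Realizer n r) :=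
  TopologicalSpace.induced
    (fun (R : Realizer n r) (p : Fin n × P × P) => decide (R.rel p.1 p.2.1 p.2.2))
    inferInstance

end Realizer

/-- The action of the topological group `G` on `X` is the universal minimal flow of `G`:
`X` is a (nonempty) compact Hausdorff space on which `G` acts continuously and minimally, and for
every minimal continuous action of `G` on a nonempty compact Hausdorff space `Y` there is a
continuous surjective `G`-homomorphism from `X` onto `Y`. -/
structure IsUniversalMinimalFlow (G : Type u) (X : Type v) [Group G] [TopologicalSpace G]
    [TopologicalSpace X] [MulAction G X] : Prop where
  nonempty : Nonempty X
  compact : CompactSpace X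
  hausdorff : T2Space X
  continuous_act : ContinuousSMul G X
  minimal : MulAction.IsMinimal G X
  universal : ∀ (Y : Type w) [TopologicalSpace Y] [CompactSpace Y] [T2Space Y] [Nonempty Y]
    [MulAction G Y] [ContinuousSMul G Y] [MulAction.IsMinimal G Y],
    ∃ f : X → Y, Continuous f ∧ Function.Surjective f ∧ ∀ (g : G) (x : X), f (g • x) = g • f x

/-- No two distinct points of `D` share a coordinate. -/
def NoColinearPoints {n : ℕ} (D : Set (Fin n → ℚ)) : Prop :=
  ∀ a ∈ D, ∀ b ∈ D, a ≠ b → ∀ i, a i ≠ b i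

/-- The product order on `D ⊆ ℚⁿ`: `a < b` iff `aᵢ ≤ bᵢ` for all `i` and `a ≠ b`. -/
def productOrder {n : ℕ} (D : Set (Fin n → ℚ)) (a b : D) : Prop :=
  (∀ i, a.1 i ≤ b.1 i) ∧ a ≠ b

/-- The `i`-th coordinate order on `D ⊆ ℚⁿ`. -/
def coordOrder {n : ℕ} (D : Set (Fin n → ℚ)) (i : Fin n) (a b : D) : Prop :=
  a.1 i < b.1 i

/-! The realizers form a single finite orbit with extremely amenable stabilizer. By a pigeonhole
argument on wide pairs, each coordinate order is one of the orders of any given realizer, so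
realizers are exactly the permuted tuples of coordinate orders (`Realizer.exists_perm`). Permuting
the coordinates of `D` yields another generic family, so back-and-forth makes the action transitive
(`exists_aut_permuting`). The stabilizer of the identity tuple lies in `coordAut D`.

Any flow `Y` has a point `y₀` fixed by `coordAut D` (`exists_fixed_point`). This is the
Kechris–Pestov–Todorcevic argument, fed by a Ramsey property that reduces to the classical Ramsey
theorem by listing the coordinates of all points in one sequence. Hence `g • y₀` depends only on the
realizer `g • permRealizer hcol 1`, which gives an equivariant map to `Y`. Its image is finite,
hence closed, and dense when `Y` is minimal. -/

/-! ### Finite Ramsey theorem via a nonprincipal ultrafilter. -/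

theorem Ultrafilter.exists_eventually_eq {α K : Type*} [Finite K] (U : Ultrafilter α)
    (f : α → K) : ∃ k, ∀ᶠ y in (U : Filter α), f y = k := by
  obtain ⟨k, hk⟩ := (U.map f).eq_pure_of_finite
  refine ⟨k, ?_⟩
  have h : {k} ∈ U.map f := by
    rw [hk]
    exact Ultrafilter.mem_pure.2 rfl
  exact Ultrafilter.mem_map.1 h

/-- The limit of a finite colouring of finite sets when `j` further elements are added one by one,
each tending to infinity along a fixed nonprincipal ultrafilter. -/
noncomputable def iteratedLimit {K : Type*} [Finite K] (c : Finset ℕ → K) : ℕ → Finset ℕ → K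
  | 0, S => c S
  | j + 1, S => ((Filter.hyperfilter ℕ).exists_eventually_eq
      fun y => iteratedLimit c j (insert y S)).choose

theorem iteratedLimit_eventually {K : Type*} [Finite K] (c : Finset ℕ → K) (j : ℕ)
    (S : Finset ℕ) : ∀ᶠ y in (Filter.hyperfilter ℕ : Filter ℕ),
      iteratedLimit c j (insert y S) = iteratedLimit c (j + 1) S :=
  ((Filter.hyperfilter ℕ).exists_eventually_eq
    fun y => iteratedLimit c j (insert y S)).choose_spec

/-- `F` grows one element at a time: only finitely many pairs `(S, j)` constrain the new element,
and each constraint holds for almost every `y`. At `j = 0` the conclusion is monochromaticity. -/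
theorem exists_iteratedLimit_homogeneous {K : Type*} [Finite K] (c : Finset ℕ → K) (k N : ℕ) :
    ∃ F : Finset ℕ, F.card = N ∧ ∀ S ⊆ F, ∀ j, S.card + j = k →
      iteratedLimit c j S = iteratedLimit c k ∅ := by
  induction N with
  | zero =>
    refine ⟨∅, rfl, fun S hS j hj => ?_⟩
    obtain rfl := Finset.subset_empty.1 hS
    simp at hj
    rw [hj]
  | succ N ih =>
    obtain ⟨F, hF, h⟩ := ih
    have h1 : ∀ᶠ y in (Filter.hyperfilter ℕ : Filter ℕ), y ∉ F :=
      Filter.hyperfilter_le_cofinite F.finite_toSet.compl_mem_cofinite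
    have h2 : ∀ᶠ y in (Filter.hyperfilter ℕ : Filter ℕ), ∀ S ∈ F.powerset, ∀ j ∈ Finset.range k,
        iteratedLimit c j (insert y S) = iteratedLimit c (j + 1) S := by
      rw [Filter.eventually_all_finset]
      intro S _
      rw [Filter.eventually_all_finset]
      intro j _
      exact iteratedLimit_eventually c j S
    obtain ⟨y, hy, hy'⟩ := (h1.and h2).exists
    refine ⟨insert y F, by rw [Finset.card_insert_of_notMem hy, hF], fun S hS j hj => ?_⟩
    by_cases hyS : y ∈ S
    · have hc := Finset.card_erase_add_one hyS
      have hsub : S.erase y ⊆ F := by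
        rwa [← Finset.subset_insert_iff]
      rw [← Finset.insert_erase hyS, hy' _ (Finset.mem_powerset.2 hsub) j
        (Finset.mem_range.2 (by omega))]
      exact h _ hsub _ (by omega)
    · exact h S ((Finset.subset_insert_iff_of_notMem hyS).1 hS) j hj

/-- The finite Ramsey theorem for hypergraphs. -/
theorem exists_monochromatic_finset {K : Type*} [Finite K] (c : Finset ℕ → K) (k N : ℕ) :
    ∃ F : Finset ℕ, F.card = N ∧ ∃ κ, ∀ S ⊆ F, S.card = k → c S = κ := by
  obtain ⟨F, hF, h⟩ := exists_iteratedLimit_homogeneous c k N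
  exact ⟨F, hF, _, fun S hS hk => h S hS 0 (by simpa using hk)⟩

/-- The finite Ramsey theorem for monotone maps between finite types ordered by means of
the keys `p` and `q`. -/
theorem exists_monochromatic_strictMono {Λ Λ' ι κ K : Type*} [LinearOrder Λ] [LinearOrder Λ']
    [Finite ι] [Finite κ] [Finite K] (p : ι → Λ) (hp : Function.Injective p)
    (q : κ → Λ') (hq : Function.Injective q) (c : (ι → ℕ) → K) :
    ∃ x : κ → ℕ, (∀ u v, q u < q v → x u < x v) ∧ ∃ col, ∀ s : ι → κ,
      (∀ u v, p u < p v → q (s u) < q (s v)) → c (x ∘ s) = col := by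
  classical
  cases nonempty_fintype ι
  cases nonempty_fintype κ
  let := LinearOrder.lift' p hp
  let := LinearOrder.lift' q hq
  have hp' : ∀ u v, u < v ↔ p u < p v := fun _ _ => Iff.rfl
  have hq' : ∀ u v, u < v ↔ q u < q v := fun _ _ => Iff.rfl
  let e : Fin (Fintype.card ι) ≃o ι := Fintype.orderIsoFinOfCardEq ι rfl
  let e' : Fin (Fintype.card κ) ≃o κ := Fintype.orderIsoFinOfCardEq κ rfl
  let c' : Finset ℕ → K := fun S =>
    if h : S.card = Fintype.card ι then c (fun u => S.orderEmbOfFin h (e.symm u)) else c 0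
  obtain ⟨F, hF, col, h⟩ := exists_monochromatic_finset c' (Fintype.card ι) (Fintype.card κ)
  have hx : StrictMono fun u => F.orderEmbOfFin hF (e'.symm u) :=
    (F.orderEmbOfFin hF).strictMono.comp e'.symm.strictMono
  refine ⟨fun u => F.orderEmbOfFin hF (e'.symm u), fun u v huv => hx huv, col, fun s hs => ?_⟩
  have hs' : StrictMono s := fun u v huv => hs u v huv
  have hxs := hx.comp hs'
  set f : ι → ℕ := (fun u => F.orderEmbOfFin hF (e'.symm u)) ∘ s with hf
  have hcard : (Finset.univ.image f).card = Fintype.card ι := by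
    rw [Finset.card_image_of_injective _ hxs.injective, Finset.card_univ]
  rw [← h (Finset.univ.image f) _ hcard]
  · have := Finset.orderEmbOfFin_unique hcard (f := f ∘ e)
      (fun x => Finset.mem_image_of_mem _ (Finset.mem_univ _)) (hxs.comp e.strictMono)
    simp only [c', hcard, dite_true]
    congr 1
    funext u
    rw [← this]
    simp
  · intro y hy
    obtain ⟨u, -, rfl⟩ := Finset.mem_image.1 hy
    exact Finset.orderEmbOfFin_mem _ _ _

/-! ### Back-and-forth between generic families. -/

/-- A finite set of pairs is a partial isomorphism between two sets of points with coordinate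
functions `p` and `q` if it preserves all coordinate orders. -/
def IsCoordPartialIso {ι P Q : Type*} (p : P → ι → ℚ) (q : Q → ι → ℚ) (f : Finset (P × Q)) : Prop :=
  ∀ x ∈ f, ∀ y ∈ f, ∀ i, p x.1 i < p y.1 i ↔ q x.2 i < q y.2 i

/-- A family of points is generic if it is dense and no two points share a coordinate. -/
structure IsGenericFamily {ι P : Type*} (p : P → ι → ℚ) : Prop where
  dense : DenseRange p
  injective : ∀ i, Function.Injective fun a => p a i

theorem IsCoordPartialIso.swap {ι P Q : Type*} {p : P → ι → ℚ} {q : Q → ι → ℚ}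
    {f : Finset (P × Q)} (hf : IsCoordPartialIso p q f) :
    IsCoordPartialIso q p (f.map (Equiv.prodComm P Q).toEmbedding) := by
  intro x hx y hy i
  obtain ⟨x', hx', rfl⟩ := Finset.mem_map.1 hx
  obtain ⟨y', hy', rfl⟩ := Finset.mem_map.1 hy
  exact (hf x' hx' y' hy' i).symm

section BackAndForth

variable {ι P Q : Type*} [Finite ι] {p : P → ι → ℚ} {q : Q → ι → ℚ}

theorem IsGenericFamily.exists_mem_box (hp : IsGenericFamily p) {u v : ι → ℚ}
    (h : ∀ i, u i < v i) : ∃ a, ∀ i, u i < p a i ∧ p a i < v i := by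
  obtain ⟨a, ha⟩ := hp.dense.exists_mem_open (s := Set.univ.pi fun i => Set.Ioo (u i) (v i))
    (isOpen_set_pi Set.finite_univ fun i _ => isOpen_Ioo)
    (Set.univ_pi_nonempty_iff.2 fun i => Set.nonempty_Ioo.2 (h i))
  exact ⟨a, fun i => ha i trivial⟩

theorem IsCoordPartialIso.exists_insert [DecidableEq P] [DecidableEq Q]
    (hp : IsGenericFamily p) (hq : IsGenericFamily q)
    {f : Finset (P × Q)} (hf : IsCoordPartialIso p q f) (a : P) :
    ∃ b, IsCoordPartialIso p q (insert (a, b) f) := by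
  by_cases h : ∃ b, (a, b) ∈ f
  · obtain ⟨b, hb⟩ := h
    exact ⟨b, by rwa [Finset.insert_eq_of_mem hb]⟩
  -- The coordinates are independent: each one prescribes a cut of finitely many rationals, which
  -- contains an open interval. Density then meets all these intervals at once.
  have cut : ∀ i, ∃ u v : ℚ, u < v ∧ (∀ x ∈ f, p x.1 i < p a i → q x.2 i ≤ u) ∧
      (∀ x ∈ f, p a i < p x.1 i → v ≤ q x.2 i) := by
    intro i
    obtain ⟨u, hu1, hu2⟩ := Order.exists_between_finsets
      ((f.filter fun x => p x.1 i < p a i).image fun x => q x.2 i)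
      ((f.filter fun x => p a i < p x.1 i).image fun x => q x.2 i) (by
        intro s hs t ht
        simp only [Finset.mem_image, Finset.mem_filter] at hs ht
        obtain ⟨x, ⟨hx, hxa⟩, rfl⟩ := hs
        obtain ⟨y, ⟨hy, hya⟩, rfl⟩ := ht
        exact (hf x hx y hy i).1 (hxa.trans hya))
    obtain ⟨v, hv1, hv2⟩ := Order.exists_between_finsets {u}
      ((f.filter fun x => p a i < p x.1 i).image fun x => q x.2 i) (by
        intro s hs t ht
        rw [Finset.mem_singleton.1 hs]
        exact hu2 t ht)
    refine ⟨u, v, hv1 u (Finset.mem_singleton_self u), fun x hx hxa => ?_, fun x hx hxa => ?_⟩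
    · exact (hu1 _ (Finset.mem_image_of_mem (fun x => q x.2 i)
        (Finset.mem_filter.2 ⟨hx, hxa⟩))).le
    · exact (hv2 _ (Finset.mem_image_of_mem (fun x => q x.2 i)
        (Finset.mem_filter.2 ⟨hx, hxa⟩))).le
  choose u v huv hu hv using cut
  obtain ⟨b, hb⟩ := hq.exists_mem_box huv
  have key : ∀ x ∈ f, ∀ i, (p x.1 i < p a i ↔ q x.2 i < q b i) ∧
      (p a i < p x.1 i ↔ q b i < q x.2 i) := by
    intro x hx i
    have hne : p x.1 i ≠ p a i := fun he => h ⟨x.2, by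
      rw [← hp.injective i he]
      exact hx⟩
    rcases lt_or_gt_of_ne hne with hl | hl
    · have h1 := (hu i x hx hl).trans_lt (hb i).1
      exact ⟨iff_of_true hl h1, iff_of_false hl.asymm h1.asymm⟩
    · have h1 := (hb i).2.trans_le (hv i x hx hl)
      exact ⟨iff_of_false hl.asymm h1.asymm, iff_of_true hl h1⟩
  refine ⟨b, fun x hx y hy i => ?_⟩
  rcases Finset.mem_insert.1 hx with rfl | hx <;> rcases Finset.mem_insert.1 hy with rfl | hy
  · simp
  · exact (key y hy i).2
  · exact (key x hx i).1
  · exact hf x hx y hy i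

theorem IsCoordPartialIso.exists_insert_right [DecidableEq P] [DecidableEq Q]
    (hp : IsGenericFamily p) (hq : IsGenericFamily q)
    {f : Finset (P × Q)} (hf : IsCoordPartialIso p q f) (b : Q) :
    ∃ a, IsCoordPartialIso p q (insert (a, b) f) := by
  obtain ⟨a, ha⟩ := hf.swap.exists_insert hq hp b
  refine ⟨a, ?_⟩
  have := ha.swap
  rwa [Finset.map_insert, Finset.map_map, show (Equiv.prodComm P Q).toEmbedding.trans
    (Equiv.prodComm Q P).toEmbedding = Function.Embedding.refl _ from rfl, Finset.map_refl] at this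

/-- Two countable generic families are isomorphic, by an isomorphism extending any given finite
partial isomorphism. -/
theorem IsCoordPartialIso.exists_equiv [Nonempty ι] [Countable P] [Countable Q]
    (hp : IsGenericFamily p) (hq : IsGenericFamily q)
    {f : Finset (P × Q)} (hf : IsCoordPartialIso p q f) :
    ∃ e : P ≃ Q, (∀ x ∈ f, e x.1 = x.2) ∧
      ∀ a b i, p a i < p b i ↔ q (e a) i < q (e b) i := by
  classical
  cases nonempty_encodable P
  cases nonempty_encodable Q
  let PI := {f : Finset (P × Q) // IsCoordPartialIso p q f}
  let defined : P ⊕ Q → Order.Cofinal PI := Sum.elim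
    (fun a => ⟨{g | ∃ b, (a, b) ∈ g.1}, fun g => by
      obtain ⟨b, hb⟩ := g.2.exists_insert hp hq a
      exact ⟨⟨_, hb⟩, ⟨b, Finset.mem_insert_self _ _⟩, Finset.subset_insert _ _⟩⟩)
    (fun b => ⟨{g | ∃ a, (a, b) ∈ g.1}, fun g => by
      obtain ⟨a, ha⟩ := g.2.exists_insert_right hp hq b
      exact ⟨⟨_, ha⟩, ⟨a, Finset.mem_insert_self _ _⟩, Finset.subset_insert _ _⟩⟩)
  -- A generic ideal: meeting the countably many cofinal sets makes the union of its members total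
  -- on both sides.
  let I : Order.Ideal PI := Order.idealOfCofinals ⟨f, hf⟩ defined
  have hleft : ∀ a, ∃ b, ∃ g ∈ I, (a, b) ∈ g.1 := fun a => by
    obtain ⟨g, ⟨b, hb⟩, hg⟩ :=
      Order.cofinal_meets_idealOfCofinals ⟨f, hf⟩ defined (Sum.inl a)
    exact ⟨b, g, hg, hb⟩
  have hright : ∀ b, ∃ a, ∃ g ∈ I, (a, b) ∈ g.1 := fun b => by
    obtain ⟨g, ⟨a, ha⟩, hg⟩ :=
      Order.cofinal_meets_idealOfCofinals ⟨f, hf⟩ defined (Sum.inr b)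
    exact ⟨a, g, hg, ha⟩
  have hcompat : ∀ x y : P × Q, (∃ g ∈ I, x ∈ g.1) → (∃ g ∈ I, y ∈ g.1) →
      ∀ i, p x.1 i < p y.1 i ↔ q x.2 i < q y.2 i := by
    rintro x y ⟨g, hg, hx⟩ ⟨g', hg', hy⟩ i
    obtain ⟨m, -, h1, h2⟩ := I.directed g hg g' hg'
    exact m.2 x (h1 hx) y (h2 hy) i
  obtain ⟨i₀⟩ := ‹Nonempty ι›
  have huniq : ∀ x y : P × Q, (∃ g ∈ I, x ∈ g.1) → (∃ g ∈ I, y ∈ g.1) →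
      (x.1 = y.1 ↔ x.2 = y.2) := by
    intro x y hx hy
    have h1 := hcompat x y hx hy i₀
    have h2 := hcompat y x hy hx i₀
    rw [← (hp.injective i₀).eq_iff, ← (hq.injective i₀).eq_iff]
    simp only [le_antisymm_iff, ← not_lt, h1, h2]
  choose F hF using hleft
  choose G hG using hright
  refine ⟨⟨F, G, fun a => ?_, fun b => ?_⟩, fun x hx => ?_, fun a b i => ?_⟩
  · exact (huniq (G (F a), F a) (a, F a) (hG _) (hF _)).2 rfl
  · exact (huniq (G b, F (G b)) (G b, b) (hF _) (hG _)).1 rfl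
  · exact (huniq (x.1, F x.1) x (hF _)
      ⟨⟨f, hf⟩, Order.mem_idealOfCofinals _ _, hx⟩).1 rfl
  · exact hcompat (a, F a) (b, F b) (hF _) (hF _) i

end BackAndForth

/-! ### Classification of the realizers. -/

section Realizers

variable {n : ℕ} {D : Set (Fin n → ℚ)}

theorem isGenericFamily_perm (hD : Dense D) (hcol : NoColinearPoints D)
    (σ : Equiv.Perm (Fin n)) : IsGenericFamily fun (a : D) i => a.1 (σ i) where
  dense := by
    have hs : Function.Surjective fun (a : Fin n → ℚ) i => a (σ i) := fun b =>
      ⟨fun i => b (σ.symm i), by simp⟩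
    exact hs.denseRange.comp hD.denseRange_val (by fun_prop)
  injective i a b hab := by
    by_contra hne
    exact hcol a a.2 b b.2 (fun h => hne (Subtype.ext h)) (σ i) hab

theorem isGenericFamily_val (hD : Dense D) (hcol : NoColinearPoints D) :
    IsGenericFamily fun (a : D) i => a.1 i :=
  isGenericFamily_perm hD hcol 1

theorem isStrictTotalOrder_coordOrder (hcol : NoColinearPoints D) (i : Fin n) :
    IsStrictTotalOrder D (coordOrder D i) :=
  (RelEmbedding.preimage ⟨fun a : D => a.1 i, fun a b hab => by
    by_contra hne
    exact hcol a a.2 b b.2 (fun h => hne (Subtype.ext h)) i hab⟩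
    ((· < ·) : ℚ → ℚ → Prop)).isStrictTotalOrder

theorem productOrder_iff_forall_lt [NeZero n] (hcol : NoColinearPoints D) (a b : D) :
    productOrder D a b ↔ ∀ i, coordOrder D i a b := by
  constructor
  · rintro ⟨h, hne⟩ i
    exact lt_of_le_of_ne (h i) (hcol a a.2 b b.2 (fun h => hne (Subtype.ext h)) i)
  · intro h
    refine ⟨fun i => (h i).le, ?_⟩
    rintro rfl
    exact lt_irrefl _ (h 0)

/-- The realizer given by the coordinate orders in the order `σ`. -/
def permRealizer [NeZero n] (hcol : NoColinearPoints D) (σ : Equiv.Perm (Fin n)) :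
    Realizer n (productOrder D) where
  rel i := coordOrder D (σ i)
  isLinear i := isStrictTotalOrder_coordOrder hcol (σ i)
  realizes a b := (productOrder_iff_forall_lt hcol a b).trans
    ⟨fun h i => h (σ i), fun h i => by simpa using h (σ.symm i)⟩

/-- `A` lies above `B` in coordinate `k`, both values being between `x` and `y`,
and `A` lies below `-M` and `B` above `M` in all other coordinates. -/
structure IsWidePair (M : ℚ) (k : Fin n) (x y : ℚ) (A B : Fin n → ℚ) : Prop where
  left : x < B k
  mid : B k < A k
  right : A k < y
  low : ∀ l ≠ k, A l < -M
  high : ∀ l ≠ k, M < B l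

theorem exists_isWidePair (hD : Dense D) (hcol : NoColinearPoints D) (M : ℚ) (k : Fin n)
    {x y : ℚ} (hxy : x < y) : ∃ A B : D, IsWidePair M k x y A.1 B.1 := by
  have hp := isGenericFamily_val hD hcol
  obtain ⟨A, hA⟩ := hp.exists_mem_box (u := fun l => if l = k then (x + y) / 2 else -M - 1)
    (v := fun l => if l = k then y else -M) (fun l => by split_ifs <;> linarith)
  obtain ⟨B, hB⟩ := hp.exists_mem_box (u := fun l => if l = k then x else M)
    (v := fun l => if l = k then (x + y) / 2 else M + 1) (fun l => by split_ifs <;> linarith)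
  have hAk := hA k
  have hBk := hB k
  simp only [if_true] at hAk hBk
  refine ⟨A, B, hBk.1, hBk.2.trans hAk.1, hAk.2, fun l hl => ?_, fun l hl => ?_⟩
  · simpa [hl] using (hA l).2
  · simpa [hl] using (hB l).1

/-- With its symmetric version, this puts `A` below `B'` and `A'` below `B` in the product order. -/
theorem IsWidePair.lt_of_ne {M : ℚ} {k k' : Fin n} {x y x' y' : ℚ} {A B A' B' : Fin n → ℚ}
    (h : IsWidePair M k x y A B) (h' : IsWidePair M k' x' y' A' B') (hk : k ≠ k')
    (hM : 0 ≤ M) (hy : y ≤ M) (hx' : -M ≤ x') (l : Fin n) : A l < B' l := by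
  by_cases h1 : l = k
  · subst h1
    exact h.right.trans_le (hy.trans (h'.high _ hk).le)
  by_cases h2 : l = k'
  · subst h2
    exact (h.low _ h1).trans_le (hx'.trans h'.left.le)
  · linarith [h.low l h1, h'.high l h2]

theorem coordOrder_injective (hD : Dense D) (hcol : NoColinearPoints D) :
    Function.Injective (coordOrder D) := by
  intro i j hij
  by_contra hne
  obtain ⟨A, B, h⟩ := exists_isWidePair hD hcol 0 i (zero_lt_one' ℚ)
  have h1 : coordOrder D j B A := hij ▸ (show coordOrder D i B A from h.mid)
  have h2 := h.low j (Ne.symm hne)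
  have h3 := h.high j (Ne.symm hne)
  have h4 : B.1 j < A.1 j := h1
  linarith

namespace Realizer

variable (R : Realizer n (productOrder D))

theorem exists_rel_of_coordOrder {k : Fin n} {a b : D} (h : coordOrder D k b a) :
    ∃ j, R.rel j b a := by
  by_contra! hne
  have hab : a ≠ b := by
    rintro rfl
    exact lt_irrefl _ h
  have : productOrder D a b := (R.realizes a b).2 fun j => by
    have := R.isLinear j
    rcases trichotomous_of (R.rel j) a b with h1 | h1 | h1
    · exact h1
    · exact absurd h1 hab
    · exact absurd h1 (hne j)
  exact absurd (this.1 k) (not_le.2 h)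

variable [NeZero n]

theorem rel_of_forall_lt {j : Fin n} {a b : D} (h : ∀ l, a.1 l < b.1 l) : R.rel j a b :=
  (R.realizes a b).1 ⟨fun l => (h l).le, fun hab => lt_irrefl _ (hab ▸ h 0)⟩ j

/-- Otherwise `B`, `A`, `B'`, `A'`, `B` would be a cycle in the order `R.rel j`. -/
theorem not_rel_of_crossing {M : ℚ} {k k' j : Fin n} {x y x' y' : ℚ} {A B A' B' : D}
    (h : IsWidePair M k x y A.1 B.1) (h' : IsWidePair M k' x' y' A'.1 B'.1) (hk : k ≠ k')
    (hM : 0 ≤ M) (hx : -M ≤ x) (hy : y ≤ M) (hx' : -M ≤ x') (hy' : y' ≤ M)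
    (hj : R.rel j B A) : ¬ R.rel j B' A' := by
  intro hj'
  have := R.isLinear j
  have h1 := R.rel_of_forall_lt (j := j) (h.lt_of_ne h' hk hM hy hx')
  have h2 := R.rel_of_forall_lt (j := j) (h'.lt_of_ne h hk.symm hM hy' hx)
  exact irrefl_of (R.rel j) B (trans_of (R.rel j) (trans_of (R.rel j) hj h1)
    (trans_of (R.rel j) hj' h2))

/-- If each order `j` failed at some pair `b j`, `a j`, a wide pair could be squeezed between them
in direction `i`. Some order puts its `B` before its `A`. Wide pairs in different directions need
different orders, so by pigeonhole the same order `t` serves direction `i` for every squeezed pair.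
For the pair chosen against `t` itself, this yields `b t`, `B t`, `A t`, `a t` in increasing order,
a contradiction. -/
theorem exists_coordOrder_le (hD : Dense D) (hcol : NoColinearPoints D) (i : Fin n) :
    ∃ j, ∀ a b, coordOrder D i b a → R.rel j b a := by
  by_contra! hcon
  choose a b hab hne using hcon
  obtain ⟨M, hM1, hMa, hMb⟩ : ∃ M : ℚ, 1 ≤ M ∧ (∀ t l, |(a t).1 l| ≤ M) ∧
      ∀ t l, |(b t).1 l| ≤ M := by
    obtain ⟨M₁, h₁⟩ := (Set.finite_range fun x : Fin n × Fin n => |(a x.1).1 x.2|).bddAbove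
    obtain ⟨M₂, h₂⟩ := (Set.finite_range fun x : Fin n × Fin n => |(b x.1).1 x.2|).bddAbove
    exact ⟨max 1 (max M₁ M₂), le_max_left _ _,
      fun t l => (h₁ ⟨(t, l), rfl⟩).trans ((le_max_left _ _).trans (le_max_right _ _)),
      fun t l => (h₂ ⟨(t, l), rfl⟩).trans ((le_max_right _ _).trans (le_max_right _ _))⟩
  have hM0 : 0 ≤ M := zero_le_one.trans hM1
  have hM1' : -M ≤ -1 := neg_le_neg hM1
  have hax := fun t => (abs_le.1 (hMa t i)).2
  have hbx := fun t => (abs_le.1 (hMb t i)).1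
  choose A B hAB using fun t => exists_isWidePair hD hcol M i (show (b t).1 i < (a t).1 i from hab t)
  choose A' B' hAB' using fun k => exists_isWidePair hD hcol M k (show (-1 : ℚ) < 1 by norm_num)
  choose J hJ using fun t => R.exists_rel_of_coordOrder (k := i) (hAB t).mid
  choose J' hJ' using fun k => R.exists_rel_of_coordOrder (k := k) (hAB' k).mid
  have hJJ' : ∀ t, ∀ k ≠ i, J t ≠ J' k := fun t k hk he =>
    R.not_rel_of_crossing (hAB t) (hAB' k) hk.symm hM0 (hbx t) (hax t) hM1' hM1 (hJ t)
      (he ▸ hJ' k)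
  have hJ'' : ∀ k k', k ≠ k' → J' k ≠ J' k' := fun k k' hk he =>
    R.not_rel_of_crossing (hAB' k) (hAB' k') hk hM0 hM1' hM1 hM1' hM1 (hJ' k) (he ▸ hJ' k')
  -- The orders used by the directions other than `i` leave just one order free, so `J t` cannot
  -- depend on `t`.
  have hinj : ∀ t, Function.Injective (Function.update J' i (J t)) := by
    intro t k k' hkk'
    by_contra hne
    by_cases h1 : k = i
    · subst h1
      rw [Function.update_self, Function.update_of_ne (Ne.symm hne)] at hkk'
      exact hJJ' t k' (Ne.symm hne) hkk'
    by_cases h2 : k' = i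
    · subst h2
      rw [Function.update_self, Function.update_of_ne hne] at hkk'
      exact hJJ' t k hne hkk'.symm
    rw [Function.update_of_ne h1, Function.update_of_ne h2] at hkk'
    exact hJ'' k k' hne hkk'
  have hJc : ∀ t t', J t = J t' := by
    intro t t'
    obtain ⟨k, hk⟩ := Finite.surjective_of_injective (hinj t) (J t')
    by_cases h1 : k = i
    · subst h1
      rwa [Function.update_self] at hk
    · rw [Function.update_of_ne h1] at hk
      exact absurd hk.symm (hJJ' t' k h1)
  set t := J i with ht
  have hrel : R.rel t (B t) (A t) := by
    have := hJ t
    rwa [hJc t i] at this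
  have := R.isLinear t
  refine hne t (trans_of (R.rel t) (trans_of (R.rel t)
    (R.rel_of_forall_lt fun l => ?_) hrel) (R.rel_of_forall_lt fun l => ?_))
  · by_cases hl : l = i
    · exact hl ▸ (hAB t).left
    · exact (abs_le.1 (hMb t l)).2.trans_lt ((hAB t).high l hl)
  · by_cases hl : l = i
    · exact hl ▸ (hAB t).right
    · exact ((hAB t).low l hl).trans_le (abs_le.1 (hMa t l)).1

/-- A strict total order contained in another equals it, and distinct coordinates have distinct
orders; the permutation is the inverse of `τ`. -/
theorem exists_perm (hD : Dense D) (hcol : NoColinearPoints D) :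
    ∃ σ : Equiv.Perm (Fin n), ∀ i, R.rel i = coordOrder D (σ i) := by
  choose τ hτ using R.exists_coordOrder_le hD hcol
  have heq : ∀ i, R.rel (τ i) = coordOrder D i := by
    intro i
    funext a b
    refine propext ⟨fun h => ?_, hτ i b a⟩
    have := R.isLinear (τ i)
    have := isStrictTotalOrder_coordOrder hcol i
    rcases trichotomous_of (coordOrder D i) a b with h1 | h1 | h1
    · exact h1
    · exact absurd (h1 ▸ h) (irrefl_of (R.rel (τ i)) b)
    · exact absurd h (asymm_of (R.rel (τ i)) (hτ i a b h1))
  have hinj : Function.Injective τ := fun i j hij =>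
    coordOrder_injective hD hcol (by rw [← heq i, ← heq j, hij])
  let e := Equiv.ofBijective τ (Finite.injective_iff_bijective.1 hinj)
  refine ⟨e.symm, fun i => ?_⟩
  rw [← heq]
  exact congrArg R.rel (e.apply_symm_apply i).symm

end Realizer

theorem permRealizer_bijective [NeZero n] (hD : Dense D) (hcol : NoColinearPoints D) :
    Function.Bijective (permRealizer hcol) := by
  constructor
  · intro σ τ h
    ext1 i
    exact coordOrder_injective hD hcol (congrFun (congrArg Realizer.rel h) i)
  · intro R
    obtain ⟨σ, hσ⟩ := R.exists_perm hD hcol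
    exact ⟨σ, Realizer.ext (funext fun i => (hσ i).symm)⟩

end Realizers

/-! ### Neighbourhoods in the automorphism group. -/

section RelAut

variable {P : Type*} {r : P → P → Prop}

theorem exists_finset_of_mem_nhds_one {s : Set (r ≃r r)} (hs : s ∈ nhds (1 : r ≃r r)) :
    ∃ A : Finset P, ∀ v : r ≃r r, (∀ a ∈ A, v a = a) → v ∈ s := by
  let : TopologicalSpace P := ⊥
  obtain ⟨t, ht, hts⟩ := (mem_nhds_induced (fun g : r ≃r r => (g : P → P)) 1 s).1 hs
  rw [nhds_pi, Filter.mem_pi] at ht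
  obtain ⟨I, hI, u, hu, hut⟩ := ht
  refine ⟨hI.toFinset, fun v hv => hts (hut fun a ha => ?_)⟩
  change v a ∈ u a
  rw [hv a (hI.mem_toFinset.2 ha)]
  exact mem_of_mem_nhds (hu a)

theorem isOpen_setOf_apply_eq (a b : P) : IsOpen {g : r ≃r r | g a = b} := by
  let : TopologicalSpace P := ⊥
  have : DiscreteTopology P := ⟨rfl⟩
  have h : Continuous fun g : r ≃r r => (g : P → P) := continuous_induced_dom
  exact (isOpen_discrete {b}).preimage ((continuous_apply a).comp h)

end RelAut

/-! ### Ramsey property and extreme amenability. -/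

section FixedPoint

variable {n : ℕ} {D : Set (Fin n → ℚ)}

/-- The automorphisms of the product order that preserve every coordinate order. -/
def coordAut (D : Set (Fin n → ℚ)) : Subgroup (productOrder D ≃r productOrder D) where
  carrier := {g | ∀ i a b, coordOrder D i (g a) (g b) ↔ coordOrder D i a b}
  one_mem' _ _ _ := Iff.rfl
  mul_mem' {g h} hg hh i a b := (hg i (h a) (h b)).trans (hh i a b)
  inv_mem' {g} hg i a b := by
    rw [← hg i, RelIso.apply_inv_self, RelIso.apply_inv_self]

variable [NeZero n]

/-- The product order is the intersection of all coordinate orders, so a bijection that permutes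
them preserves it. The case `σ = 1` gives homogeneity, general `σ` transitivity on realizers. -/
theorem exists_aut_permuting (hD : Dense D) (hcol : NoColinearPoints D) (σ : Equiv.Perm (Fin n))
    {f : Finset (D × D)}
    (hf : IsCoordPartialIso (fun (a : D) i => a.1 i) (fun (a : D) i => a.1 (σ i)) f) :
    ∃ g : productOrder D ≃r productOrder D, (∀ x ∈ f, g x.1 = x.2) ∧
      ∀ i a b, coordOrder D i a b ↔ coordOrder D (σ i) (g a) (g b) := by
  obtain ⟨e, he, he'⟩ := hf.exists_equiv (isGenericFamily_val hD hcol)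
    (isGenericFamily_perm hD hcol σ)
  refine ⟨⟨e, fun {a b} => ?_⟩, he, fun i a b => he' a b i⟩
  rw [productOrder_iff_forall_lt hcol, productOrder_iff_forall_lt hcol, ← σ.forall_congr_right]
  exact forall_congr' fun i => (he' a b i).symm

/-- The Ramsey property of the structure formed by `D` with its coordinate orders: given a finite
colouring of the copies of `A`, there is a copy of `B` in which all copies of `A` have the same
colour. -/
theorem exists_monochromatic_copy (hD : Dense D) (hcol : NoColinearPoints D) (A B : Finset D)
    {K : Type*} [Finite K] (c : (A → D) → K) :
    ∃ γ ∈ coordAut D, ∃ col, ∀ h ∈ coordAut D, (∀ a ∈ A, h a ∈ B) →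
      c (fun a => γ (h a)) = col := by
  classical
  have hp := isGenericFamily_val hD hcol
  -- `d s` lies in the unit box with lower corner `s`, so strict inequalities between natural
  -- coordinates transfer to `D`.
  choose d hd using fun s : Fin n → ℕ => hp.exists_mem_box (u := fun i => (s i : ℚ))
    (v := fun i => (s i : ℚ) + 1) (fun i => by linarith)
  have hdlt : ∀ (s t : Fin n → ℕ) i, s i < t i → (d s).1 i < (d t).1 i := by
    intro s t i hst
    have h1 : (s i : ℚ) + 1 ≤ t i := by exact_mod_cast hst
    exact (hd s i).2.trans_le (h1.trans (hd t i).1.le)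
  -- Pairs (coordinate, point) are ordered lexicographically. A coordinate-preserving map from `A`
  -- to `B` then acts increasingly on pairs, so a copy of `A` becomes a subset of fixed size of one
  -- sequence.
  have key_inj : ∀ S : Finset D, Function.Injective
      fun u : Fin n × S => (toLex (u.1, u.2.1.1 u.1) : Fin n ×ₗ ℚ) := by
    rintro S ⟨i, a⟩ ⟨j, b⟩ h
    obtain ⟨h1, h2⟩ := Prod.mk.inj (toLex.injective h)
    dsimp only at h1 h2
    subst h1
    have hab : a = b := Subtype.ext (hp.injective i h2)
    rw [hab]
  have key_lt : ∀ (S T : Finset D) (u v : Fin n × S) (u' v' : Fin n × T), u.1 = u'.1 →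
      v.1 = v'.1 → (u.1 = v.1 → u.2.1.1 u.1 < v.2.1.1 u.1 → u'.2.1.1 u.1 < v'.2.1.1 u.1) →
      (toLex (u.1, u.2.1.1 u.1) : Fin n ×ₗ ℚ) < toLex (v.1, v.2.1.1 v.1) →
      (toLex (u'.1, u'.2.1.1 u'.1) : Fin n ×ₗ ℚ) < toLex (v'.1, v'.2.1.1 v'.1) := by
    rintro S T ⟨i, a⟩ ⟨j, b⟩ ⟨i', a'⟩ ⟨j', b'⟩ h1 h2 h h3
    dsimp only at h1 h2 h h3 ⊢
    subst h1 h2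
    rw [Prod.Lex.toLex_lt_toLex] at h3 ⊢
    rcases h3 with h3 | ⟨h3, h4⟩
    · exact Or.inl h3
    · dsimp only at h3 h4
      subst h3
      exact Or.inr ⟨rfl, h rfl h4⟩
  obtain ⟨x, hx, col, hcolor⟩ := exists_monochromatic_strictMono _ (key_inj A) _ (key_inj B)
    (fun s : Fin n × A → ℕ => c fun a => d fun i => s (i, a))
  have hxlt : ∀ (β β' : B) i, β.1.1 i < β'.1.1 i →
      (d fun j => x (j, β)).1 i < (d fun j => x (j, β')).1 i := by
    intro β β' i h
    refine hdlt _ _ i (hx _ _ ?_)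
    rw [Prod.Lex.toLex_lt_toLex]
    exact Or.inr ⟨rfl, h⟩
  have hf : IsCoordPartialIso (fun (a : D) i => a.1 i)
      (fun (a : D) i => a.1 ((1 : Equiv.Perm (Fin n)) i))
      (B.attach.image fun β => (β.1, d fun j => x (j, β))) := by
    intro u hu v hv i
    obtain ⟨β, -, rfl⟩ := Finset.mem_image.1 hu
    obtain ⟨β', -, rfl⟩ := Finset.mem_image.1 hv
    refine ⟨hxlt β β' i, fun h => ?_⟩
    rcases lt_trichotomy (β.1.1 i) (β'.1.1 i) with h1 | h1 | h1
    · exact h1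
    · rw [Subtype.ext (hp.injective i h1)] at h
      exact absurd h (lt_irrefl _)
    · exact absurd h (hxlt β' β i h1).asymm
  obtain ⟨γ, hγ, hγ'⟩ := exists_aut_permuting hD hcol 1 hf
  refine ⟨γ, fun i a b => (hγ' i a b).symm, col, fun h hh hAB => ?_⟩
  rw [← hcolor fun u => (u.1, ⟨h u.2, hAB _ u.2.2⟩)]
  · congr 1
    funext a
    exact hγ _ (Finset.mem_image_of_mem _ (Finset.mem_attach B ⟨h a, hAB _ a.2⟩))
  · intro u v huv
    exact key_lt A B u v _ _ rfl rfl (fun _ => (hh u.1 u.2.1 v.2.1).2) huv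

variable {Y : Type*} [TopologicalSpace Y] [CompactSpace Y] [T2Space Y] [Nonempty Y]
  [MulAction (productOrder D ≃r productOrder D) Y]
  [ContinuousSMul (productOrder D ≃r productOrder D) Y]

/-- The group of automorphisms preserving the coordinate orders is extremely amenable
(for restrictions of flows of the automorphism group of the product order). -/
theorem exists_fixed_point (hD : Dense D) (hcol : NoColinearPoints D) :
    ∃ y : Y, ∀ h ∈ coordAut D, h • y = y := by
  classical
  let : UniformSpace Y := uniformSpaceOfCompactR1
  -- Compactness of `Y` makes continuity at the identity uniform in `y`.
  have small : ∀ V ∈ uniformity Y, ∃ A : Finset D, ∀ v : productOrder D ≃r productOrder D,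
      (∀ a ∈ A, v a = a) → ∀ y : Y, (v • y, y) ∈ V := by
    intro V hV
    have h1 : ∀ᶠ g in nhds (1 : productOrder D ≃r productOrder D), ∀ y ∈ (Set.univ : Set Y),
        (g • y, y) ∈ V := by
      refine isCompact_univ.eventually_forall_of_forall_eventually fun y _ => ?_
      have hc : Continuous fun z : (productOrder D ≃r productOrder D) × Y =>
          (z.1 • z.2, z.2) := by fun_prop
      have h2 := hc.tendsto (1, y)
      simp only [one_smul] at h2
      exact h2 (nhds_le_uniformity y hV)
    obtain ⟨A, hA⟩ := exists_finset_of_mem_nhds_one h1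
    exact ⟨A, fun v hv y => hA v hv y trivial⟩
  have approx : ∀ V ∈ uniformity Y, ∀ E : Finset (coordAut D), ∃ y : Y, ∀ h ∈ E,
      (h.1 • y, y) ∈ V := by
    intro V hV E
    obtain ⟨V', hV', hsymm', hVV'⟩ := comp_symm_mem_uniformity_sets hV
    obtain ⟨W, hW, hsymm, hWV'⟩ := comp_symm_mem_uniformity_sets hV'
    obtain ⟨A, hA⟩ := small W hW
    obtain ⟨t, ht, hcover⟩ := isCompact_univ.totallyBounded W hW
    have := ht.to_subtype
    have hcol' : ∀ y : Y, ∃ z : t, (y, z.1) ∈ W := fun y => by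
      obtain ⟨z, hz, hyz⟩ := Set.mem_iUnion₂.1 (hcover (Set.mem_univ y))
      exact ⟨⟨z, hz⟩, hyz⟩
    choose colour hcolour using hcol'
    obtain ⟨y₀⟩ := ‹Nonempty Y›
    -- An embedding is coloured by a net point near `g⁻¹ • y₀`, for some `g` extending it. Two
    -- extensions differ by an element fixing `A`, so the choice costs only one `W`. The default
    -- `y₀` is never used on restrictions of elements of `coordAut D`.
    let c : (A → D) → t := fun e => colour
      (if h : ∃ g ∈ coordAut D, ∀ a : A, g a = e a then h.choose⁻¹ • y₀ else y₀)
    have hc : ∀ k ∈ coordAut D, (k⁻¹ • y₀, (c fun a => k a).1) ∈ V' := by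
      intro k hk
      have hex : ∃ g ∈ coordAut D, ∀ a : A, g a = k a := ⟨k, hk, fun _ => rfl⟩
      refine hWV' ⟨hex.choose⁻¹ • y₀, ?_, ?_⟩
      · have := hA (k⁻¹ * hex.choose) (fun a ha => by
          rw [RelIso.mul_apply, hex.choose_spec.2 ⟨a, ha⟩, RelIso.inv_apply_self])
          (hex.choose⁻¹ • y₀)
        rwa [smul_smul, mul_inv_cancel_right] at this
      · simp only [c, dif_pos hex]
        exact hcolour _
    -- This target contains `A` and every `h⁻¹ A`, so `γ` and `γ * h⁻¹` get the same colour; hence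
    -- `γ⁻¹ • y₀` and `h • γ⁻¹ • y₀` are both near `col`.
    obtain ⟨γ, hγ, col, hmono⟩ := exists_monochromatic_copy hD hcol A
      (A ∪ E.biUnion fun h => A.image fun a => h.1⁻¹ a) c
    refine ⟨γ⁻¹ • y₀, fun h hh => hVV' ⟨col.1, ?_, hsymm'.symm _ _ ?_⟩⟩
    · have h1 := hc (γ * h.1⁻¹) (mul_mem hγ (inv_mem h.2))
      have h2 := hmono h.1⁻¹ (inv_mem h.2) fun a ha => Finset.mem_union_right _
        (Finset.mem_biUnion.2 ⟨h, hh, Finset.mem_image_of_mem _ ha⟩)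
      rw [mul_inv_rev, inv_inv, mul_smul] at h1
      rw [← h2]
      exact h1
    · have h1 := hc γ hγ
      have h2 := hmono 1 (one_mem _) fun a ha => Finset.mem_union_left _ ha
      rw [← h2]
      exact h1
  -- Closed entourages make the sets of almost fixed points closed, so compactness turns approximate
  -- fixed points into an exact one.
  let C : coordAut D × {V : Set (Y × Y) // V ∈ uniformity Y ∧ IsClosed V} → Set Y :=
    fun z => {y | (z.1.1 • y, y) ∈ z.2.1}
  have hclosed : ∀ z, IsClosed (C z) := fun z =>
    z.2.2.2.preimage ((continuous_const_smul z.1.1).prodMk continuous_id)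
  obtain ⟨y, hy⟩ : (⋂ z, C z).Nonempty := by
    refine CompactSpace.iInter_nonempty hclosed fun F => ?_
    have hV : (⋂ z ∈ F, z.2.1) ∈ uniformity Y :=
      (Filter.biInter_finset_mem F).2 fun z _ => z.2.2.1
    obtain ⟨y, hy⟩ := approx _ hV (F.image Prod.fst)
    refine ⟨y, Set.mem_iInter₂.2 fun z hz => ?_⟩
    exact Set.mem_iInter₂.1 (hy z.1 (Finset.mem_image_of_mem _ hz)) z hz
  refine ⟨y, fun h hh => eq_of_uniformity_basis uniformity_hasBasis_closed fun {V} hV => ?_⟩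
  exact Set.mem_iInter.1 hy (⟨h, hh⟩, ⟨V, hV.1, hV.2⟩)

end FixedPoint

/-! ### Topology of the space of realizers. -/

namespace Realizer

variable {n : ℕ} {P : Type*} {r : P → P → Prop}

open Classical in
theorem continuous_decide_rel (i : Fin n) (a b : P) :
    Continuous fun R : Realizer n r => decide (R.rel i a b) :=
  (continuous_apply (i, a, b)).comp (continuous_induced_dom
    (f := fun (R : Realizer n r) (p : Fin n × P × P) => decide (R.rel p.1 p.2.1 p.2.2)))

instance : T2Space (Realizer n r) := by
  classical
  refine T2Space.of_injective_continuous
    (f := fun (R : Realizer n r) (p : Fin n × P × P) => decide (R.rel p.1 p.2.1 p.2.2))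
    (fun R S h => ?_) continuous_induced_dom
  ext i a b
  simpa using congrFun h (i, a, b)

instance : ContinuousSMul (r ≃r r) (Realizer n r) where
  continuous_smul := by
    classical
    refine continuous_induced_rng.2 (continuous_pi fun ⟨i, a, b⟩ => ?_)
    rw [continuous_iff_continuousAt]
    rintro ⟨g, R⟩
    -- `h⁻¹ a` is locally constant in `h`, so near `(g, R)` each entry of the image depends on the
    -- realizer alone.
    have hinv : ∀ a, ∀ᶠ h in nhds g, h⁻¹ a = g⁻¹ a := fun a => by
      filter_upwards [(isOpen_setOf_apply_eq (r := r) (g⁻¹ a) a).mem_nhds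
        (show g (g⁻¹ a) = a from RelIso.apply_inv_self g a)] with h hh
      rw [← RelIso.inv_apply_self h (g⁻¹ a), show h (g⁻¹ a) = a from hh]
    refine (((continuous_decide_rel i (g⁻¹ a) (g⁻¹ b)).comp continuous_snd).continuousAt
      (x := (g, R))).congr ?_
    filter_upwards [continuous_fst.continuousAt.eventually (hinv a),
      continuous_fst.continuousAt.eventually (hinv b)] with z ha hb
    change decide (z.2.rel i (g⁻¹ a) (g⁻¹ b)) = decide (z.2.rel i (z.1⁻¹ a) (z.1⁻¹ b))
    rw [ha, hb]

end Realizer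

/-! ### Universality of the finite orbit. -/

section UniversalMinimalFlow

variable {n : ℕ} [NeZero n] {D : Set (Fin n → ℚ)}

theorem exists_smul_permRealizer (hD : Dense D) (hcol : NoColinearPoints D)
    (R : Realizer n (productOrder D)) :
    ∃ g : productOrder D ≃r productOrder D, g • permRealizer hcol 1 = R := by
  obtain ⟨σ, hσ⟩ := R.exists_perm hD hcol
  obtain ⟨g, -, hg⟩ := exists_aut_permuting hD hcol σ (f := ∅) (by simp [IsCoordPartialIso])
  refine ⟨g, ?_⟩
  ext i a b
  rw [hσ i]
  have h := hg i (g⁻¹ a) (g⁻¹ b)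
  rw [RelIso.apply_inv_self, RelIso.apply_inv_self] at h
  exact h

theorem mem_coordAut_of_smul_eq (hcol : NoColinearPoints D)
    {g : productOrder D ≃r productOrder D} (hg : g • permRealizer hcol 1 = permRealizer hcol 1) :
    g ∈ coordAut D := by
  rw [← inv_mem_iff]
  intro i a b
  exact iff_of_eq (congrFun (congrFun (congrFun (congrArg Realizer.rel hg) i) a) b)

theorem isUniversalMinimalFlow_realizer (hD : Dense D) (hcol : NoColinearPoints D) :
    IsUniversalMinimalFlow.{0, 0, w} (productOrder D ≃r productOrder D)
      (Realizer n (productOrder D)) := by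
  have hfin : Finite (Realizer n (productOrder D)) :=
    Finite.of_surjective _ (permRealizer_bijective hD hcol).2
  have : MulAction.IsPretransitive (productOrder D ≃r productOrder D)
      (Realizer n (productOrder D)) := by
    refine ⟨fun R S => ?_⟩
    obtain ⟨g, rfl⟩ := exists_smul_permRealizer hD hcol R
    obtain ⟨h, rfl⟩ := exists_smul_permRealizer hD hcol S
    exact ⟨h * g⁻¹, by rw [mul_smul, inv_smul_smul]⟩
  refine ⟨⟨permRealizer hcol 1⟩, inferInstance, inferInstance, inferInstance, inferInstance, ?_⟩
  intro Y _ _ _ _ _ _ _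
  obtain ⟨y₀, hy₀⟩ := exists_fixed_point (Y := Y) hD hcol
  choose s hs using fun R => exists_smul_permRealizer hD hcol R
  -- `s (g • R)` and `g * s R` send the base realizer to the same place, so they differ by an
  -- element fixing `y₀`.
  have hequiv : ∀ (g : productOrder D ≃r productOrder D) R, s (g • R) • y₀ = g • s R • y₀ := by
    intro g R
    have h1 : (g * s R)⁻¹ * s (g • R) ∈ coordAut D := by
      refine mem_coordAut_of_smul_eq hcol ?_
      rw [mul_smul, hs, inv_smul_eq_iff, mul_smul, hs]
    have h2 := hy₀ _ h1
    rwa [mul_smul, inv_smul_eq_iff, mul_smul] at h2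
  have hdense : Dense (Set.range fun R => s R • y₀) := by
    refine (MulAction.dense_orbit (productOrder D ≃r productOrder D)
      (s (permRealizer hcol 1) • y₀)).mono ?_
    rintro _ ⟨g, rfl⟩
    exact ⟨g • permRealizer hcol 1, hequiv g _⟩
  refine ⟨fun R => s R • y₀, continuous_of_discreteTopology, ?_, hequiv⟩
  rw [← Set.range_eq_univ, ← (Set.finite_range _).isClosed.closure_eq]
  exact hdense.closure_eq

end UniversalMinimalFlow

theorem theorem6p6 (n : ℕ) (hn : 2 ≤ n) (D : Set (Fin n → ℚ)) (hD : Dense D)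
    (hcol : NoColinearPoints D) :
    IsUniversalMinimalFlow.{0, 0, w} (productOrder D ≃r productOrder D)
        (Realizer n (productOrder D)) ∧
      Finite (Realizer n (productOrder D)) ∧
      Nat.card (Realizer n (productOrder D)) = n.factorial ∧
      Set.range (Realizer.rel : Realizer n (productOrder D) → Fin n → D → D → Prop) =
        Set.range (fun (σ : Equiv.Perm (Fin n)) (i : Fin n) => coordOrder D (σ i)) := by
  have : NeZero n := ⟨by omega⟩
  have hbij := permRealizer_bijective hD hcol
  refine ⟨isUniversalMinimalFlow_realizer hD hcol, Finite.of_surjective _ hbij.2, ?_, ?_⟩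
  · rw [← Nat.card_congr (Equiv.ofBijective _ hbij), Nat.card_perm, Nat.card_fin]
  · rw [← hbij.2.range_comp]
    rfl
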